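/- Let $k\ge 1$ and $s\ge 2k+1$ be integers and put $n=s^2$. Let $\mathcal H_{2,k}$ be the $k$-hop two-dimensional torus radio hyper-graph: its vertices are the $n$ points of the discrete torus $(\mathbb Z/s\mathbb Z)^2$, and every vertex $v$ is the origin of exactly one directed hyper-edge, whose destination set consists of all vertices $w\ne v$ at $L_1$-distance at most $k$ from $v$ on the torus. The simple random walk on $\mathcal H_{2,k}$ is the process $(X(t),e(t))_{t\ge 0}$ in which, given $X(t)$, $e(t)$ is chosen uniformly among the hyper-edges with origin $X(t)$ (here there is just one), and $X(t+1)$ is then chosen uniformly from the destination set of $e(t)$. For vertices $u,v$, the radio hitting time $\tilde h(u,v)$ is the expectation of $\inf\{t\ge 0 : v\in e(t)\}$ for the walk with $X(0)=u$, where $v\in e$ means that $v$ is the origin or one of the destinations of $e$; let $\tilde h_{\max}=\max_{u,v}\tilde h(u,v)$. Then all hyper-edges of $\mathcal H_{2,k}$ have the same number $d=2k(k+1)$ of destinations, and $$\tilde h_{\max}=O\!\left(\frac nd\log\frac nd\right);$$ that is, there is an absolute constant $C>0$ such that $\tilde h_{\max}\le C\,\frac nd\log\frac nd$ for all integers $k\ge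 1$ and $s\ge 2k+1$. -/

import Mathlib

open MeasureTheory ProbabilityTheory
open scoped ENNReal

noncomputable section

/-- A finite directed hyper-graph with vertex set `V`, whose hyper-arcs are listed without repetition
by `E`: each hyper-arc `e` is a pair `(org e, dst e)` of nonempty sets of vertices. -/
structure DirHypergraph (V E : Type) where
  org : E → Finset V
  dst : E → Finset V
  org_nonempty : ∀ e, (org e).Nonempty
  dst_nonempty : ∀ e, (dst e).Nonempty
  injective_arc : Function.Injective fun e => (org e, dst e)

/-- A radio hyper-graph: every hyper-arc has exactly one origin, which is not a destination. -/
structure RadioHypergraph (V E : Type) extends DirHypergraph V E where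
  card_org : ∀ e, (org e).card = 1
  org_notMem_dst : ∀ e, ∀ v ∈ org e, v ∉ dst e

/-- The situation of the walk at a time `t`: its location `X(t)` and the hyper-arc `e(t)` on which it
moves next. -/
structure WalkState (V E : Type) where
  loc : V
  arc : E

instance instMeasurableSpaceWalkState (V E : Type) : MeasurableSpace (WalkState V E) := ⊤

namespace DirHypergraph

variable {V E : Type} (H : DirHypergraph V E)

/-- The hyper-arc `e` meets the set `U` of vertices (in its origin or in its destination). -/
def Meets (e : E) (U : Set V) : Prop := ∃ u ∈ U, u ∈ H.org e ∨ u ∈ H.dst e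

/-- All hyper-arcs are sent to exactly `d` receivers. -/
def IsUniformOfDegree (d : ℕ) : Prop := ∀ e, (H.dst e).card = d

/-- The first time `t` at which the message travels on a hyper-arc that meets `U`
(`⊤` if there is none). -/
def radioTime (U : Set V) (ω : ℕ → WalkState V E) : ℕ∞ :=
  ⨅ (t : ℕ) (_ : H.Meets (ω t).arc U), (t : ℕ∞)

variable [Fintype E]

open Classical in
/-- The hyper-arcs that leave `v`. -/
def outArcs (v : V) : Finset E := Finset.univ.filter fun e => v ∈ H.org e

theorem outArcs_nonempty {v : V} (h : ∃ e, v ∈ H.org e) : (H.outArcs v).Nonempty := by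
  obtain ⟨e, he⟩ := h
  exact ⟨e, by simp [outArcs, he]⟩

variable (hout : ∀ v, ∃ e, v ∈ H.org e)

/-- The walk is at `v`: its next hyper-arc is uniform among the hyper-arcs that leave `v`. -/
def chooseArc (v : V) : PMF (WalkState V E) :=
  (PMF.uniformOfFinset (H.outArcs v) (H.outArcs_nonempty (hout v))).map fun e => ⟨v, e⟩

/-- One step of the simple random walk: move to a uniform destination of the current hyper-arc, then
choose the next hyper-arc. -/
def stepPMF (x : WalkState V E) : PMF (WalkState V E) :=
  (PMF.uniformOfFinset (H.dst x.arc) (H.dst_nonempty x.arc)).bind (H.chooseArc hout)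

/-- The transition kernel from the history up to time `n` to the situation at time `n + 1`. -/
def stepKernel (n : ℕ) :
    Kernel (Finset.Iic n → WalkState V E) (WalkState V E) :=
  Kernel.comap ⟨fun x => (H.stepPMF hout x).toMeasure, measurable_from_top⟩
    (fun x : Finset.Iic n → WalkState V E => x ⟨n, Finset.mem_Iic.2 le_rfl⟩)
    (measurable_pi_apply _)

instance isMarkovKernel_stepKernel (n : ℕ) : IsMarkovKernel (H.stepKernel hout n) :=
  ⟨fun x => PMF.toMeasure.isProbabilityMeasure
    (H.stepPMF hout (x ⟨n, Finset.mem_Iic.2 le_rfl⟩))⟩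

/-- The law, on trajectories, of the simple random walk `(X(t), e(t))` with `X(0) = v`. -/
def walkLaw (v : V) : Measure (ℕ → WalkState V E) :=
  ((H.chooseArc hout v).toMeasure.map
    (fun x : WalkState V E => fun _ : Finset.Iic 0 => x)).bind
      (Kernel.traj (X := fun _ => WalkState V E) (H.stepKernel hout) 0)

/-- The radio hitting time from `v` to `U`. -/
def radioHittingTime (v : V) (U : Set V) : ℝ≥0∞ :=
  ∫⁻ ω, (H.radioTime U ω : ℝ≥0∞) ∂(H.walkLaw hout v)

/-- The maximum radio hitting time between two vertices. -/
def maxRadioHittingTime : ℝ≥0∞ :=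
  ⨆ (u : V) (v : V), H.radioHittingTime hout u {v}

end DirHypergraph

/-- The `L₁`-distance on the discrete torus `(ℤ/s)²`; `(a.valMinAbs).natAbs` is the distance from
`a` to `0` on the cycle `ℤ/s`. -/
def torusDist {s : ℕ} (u v : ZMod s × ZMod s) : ℕ :=
  (v.1 - u.1).valMinAbs.natAbs + (v.2 - u.2).valMinAbs.natAbs

theorem exists_torusDist_le {s k : ℕ} [NeZero s] (hs : 2 ≤ s) (hk : 1 ≤ k) (u : ZMod s × ZMod s) :
    ∃ v, v ≠ u ∧ torusDist u v ≤ k := by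
  have : Fact (1 < s) := ⟨hs⟩
  refine ⟨(u.1 + 1, u.2), fun h => one_ne_zero (α := ZMod s) ?_, ?_⟩
  · simpa using congrArg Prod.fst h
  · have h : (1 : ZMod s).valMinAbs.natAbs ≤ 1 := by
      rw [ZMod.valMinAbs_natAbs_eq_min, ZMod.val_one]
      exact min_le_left _ _
    simp only [torusDist, add_sub_cancel_left, sub_self, ZMod.valMinAbs_zero, Int.natAbs_zero]
    omega

/-- The `k`-hop 2-dimensional torus radio hyper-graph on the `s × s` torus: every node `v` is the
origin of one hyper-arc (also named `v`), whose destinations are the other nodes at `L₁`-distance at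
most `k` from `v`. -/
def torusRadio (s k : ℕ) [NeZero s] (hs : 2 ≤ s) (hk : 1 ≤ k) :
    RadioHypergraph (ZMod s × ZMod s) (ZMod s × ZMod s) where
  org v := {v}
  dst v := Finset.univ.filter fun w => w ≠ v ∧ torusDist v w ≤ k
  org_nonempty v := Finset.singleton_nonempty v
  dst_nonempty v := by
    obtain ⟨w, hw⟩ := exists_torusDist_le hs hk v
    exact ⟨w, by simpa using hw⟩
  injective_arc v w h := by simpa using congrArg Prod.fst h
  card_org v := Finset.card_singleton v
  org_notMem_dst v w hw := by
    rw [Finset.mem_singleton] at hw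
    simp [hw]

theorem torusRadio_out (s k : ℕ) [NeZero s] (hs : 2 ≤ s) (hk : 1 ≤ k) (v : ZMod s × ZMod s) :
    ∃ e, v ∈ (torusRadio s k hs hk).org e :=
  ⟨v, Finset.mem_singleton_self v⟩

end

/-! The bound follows from a Lyapunov function: if `F ≥ 0` drops in mean by at least one at each
step taken from an arc that misses the target, then `sup F` bounds the radio hitting time
(`radioHittingTime_le_lintegral`). On the torus, `F` is a function of the squared Euclidean distance
`y` to the target, increasing in `y` and made of three terms.

The main term is a smoothed logarithm, since the logarithm is harmonic in the plane. Averaging over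
the four quarter turns of a step leaves only a second-order error, and the correction `-4κ/(y+κ)`
with `κ = k²` removes it once `y ≥ 5κ` (`sum_smoothLog_le`). Nearer to the target a bounded excess
remains. It is paid for by subtracting a multiple of a Gaussian of width about `k`, whose mean at
least doubles in one step from any point outside the diamond (`sum_exp_ge`). Finally, `-4y/(k(k+1))`
supplies the drift of minus one, because a step raises the mean square by at least `k(k+1)/4`
(`sum_sq_add_sq_ge`).

The logarithm has a coefficient of order `n/d`, just large enough to keep the sum increasing despite
the last term (`torusPotential_mono`). Wrapping around the torus only shortens distances, so
monotonicity carries the planar drift to the torus. The oscillation of `F` is the coefficient times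
the logarithm of a ratio of order `s²/k²`, plus constants: `O((n/d) log (n/d))`. -/

namespace DirHypergraph

/-! ### Lyapunov bounds for radio hitting times. -/

variable {V E : Type} (H : DirHypergraph V E)

/-- The trajectories that have not met `U` strictly before time `N`. -/
def unmetBefore (U : Set V) (N : ℕ) : Set (ℕ → WalkState V E) :=
  {ω | ∀ i < N, ¬ H.Meets (ω i).arc U}

/-- The `t`-th term is the indicator that the meeting time exceeds `t`, hence the shift to `t + 1`.
If no meeting ever occurs, every term is one and the sum is infinite. -/
theorem radioTime_le_tsum (U : Set V) (ω : ℕ → WalkState V E) :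
    (H.radioTime U ω : ℝ≥0∞) ≤ ∑' t, (H.unmetBefore U (t + 1)).indicator 1 ω := by
  classical
  by_cases h : ∃ t, H.Meets (ω t).arc U
  · have h1 : H.radioTime U ω ≤ (Nat.find h : ℕ∞) :=
      iInf₂_le (f := fun (t : ℕ) (_ : H.Meets (ω t).arc U) => (t : ℕ∞)) _ (Nat.find_spec h)
    calc (H.radioTime U ω : ℝ≥0∞) ≤ ((Nat.find h : ℕ∞) : ℝ≥0∞) := by exact_mod_cast h1
      _ = ∑ t ∈ Finset.range (Nat.find h),
            (H.unmetBefore U (t + 1)).indicator (1 : (ℕ → WalkState V E) → ℝ≥0∞) ω := by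
          rw [Finset.sum_congr rfl (g := fun _ => (1 : ℝ≥0∞))]
          · simp
          · intro t ht
            rw [Set.indicator_of_mem]
            · rfl
            · intro i hi
              exact Nat.find_min h (by have := Finset.mem_range.1 ht; omega)
      _ ≤ _ := ENNReal.sum_le_tsum _
  · have h1 : ∀ t, (H.unmetBefore U (t + 1)).indicator (1 : (ℕ → WalkState V E) → ℝ≥0∞) ω = 1 := by
      intro t
      rw [Set.indicator_of_mem]
      · rfl
      · intro i _ hi
        exact h ⟨i, hi⟩
    simp [h1]

theorem measurableSet_unmetBefore (U : Set V) (N : ℕ) :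
    MeasurableSet (H.unmetBefore U N) := by
  have : H.unmetBefore U N =
      ⋂ i, ⋂ _ : i < N, (fun ω : ℕ → WalkState V E => ω i) ⁻¹' {x | ¬ H.Meets x.arc U} := by
    ext ω; simp [unmetBefore]
  rw [this]
  exact MeasurableSet.iInter fun i => MeasurableSet.iInter fun _ =>
    measurable_pi_apply i (MeasurableSpace.measurableSet_top)

variable [Fintype E] (hout : ∀ v, ∃ e, v ∈ H.org e)

theorem walkLaw_eq_trajMeasure (v : V) :
    H.walkLaw hout v =
      Kernel.trajMeasure (X := fun _ => WalkState V E) (H.chooseArc hout v).toMeasure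
        (H.stepKernel hout) := by
  rfl

/-- Markov property at time `N`: the event of no meeting through time `N` is determined by the
history, so the drift hypothesis may be applied at `ω N` inside the integral. -/
theorem lintegral_unmetBefore_succ_le (U : Set V) (F : E → ℝ≥0∞)
    (hF : ∀ x : WalkState V E, ¬ H.Meets x.arc U →
      ∫⁻ y, F y.arc ∂(H.stepPMF hout x).toMeasure + 1 ≤ F x.arc) (v : V) (N : ℕ) :
    ∫⁻ ω, (H.unmetBefore U (N + 1)).indicator (fun ω => F (ω (N + 1)).arc) ω ∂H.walkLaw hout v
      + ∫⁻ ω, (H.unmetBefore U (N + 1)).indicator 1 ω ∂H.walkLaw hout v ≤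
    ∫⁻ ω, (H.unmetBefore U N).indicator (fun ω => F (ω N).arc) ω ∂H.walkLaw hout v := by
  set P := H.walkLaw hout v with hP
  have hFm : Measurable fun x : WalkState V E => F x.arc := measurable_from_top
  let S : Set (Finset.Iic N → WalkState V E) := {x | ∀ i, ¬ H.Meets (x i).arc U}
  have hS : MeasurableSet S := by
    have : S = ⋂ i, (fun x : Finset.Iic N → WalkState V E => x i) ⁻¹'
        {x | ¬ H.Meets x.arc U} := by
      ext ω; simp [S]
    rw [this]
    exact MeasurableSet.iInter fun i =>
      measurable_pi_apply i (MeasurableSpace.measurableSet_top)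
  have hSmem : ∀ ω : ℕ → WalkState V E,
      Preorder.frestrictLe N ω ∈ S ↔ ω ∈ H.unmetBefore U (N + 1) := by
    intro ω
    simp [S, unmetBefore]
  let G : (Finset.Iic N → WalkState V E) × WalkState V E → ℝ≥0∞ :=
    fun p => S.indicator 1 p.1 * F p.2.arc
  have hSm : Measurable (S.indicator (1 : (Finset.Iic N → WalkState V E) → ℝ≥0∞)) :=
    measurable_one.indicator hS
  have hG : Measurable G := (hSm.comp measurable_fst).mul (hFm.comp measurable_snd)
  have key := Kernel.map_frestrictLe_trajMeasure_compProd_eq_map_trajMeasure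
    (X := fun _ => WalkState V E) (μ₀ := (H.chooseArc hout v).toMeasure)
    (κ := H.stepKernel hout) (a := N)
  rw [← walkLaw_eq_trajMeasure, ← hP] at key
  have : IsProbabilityMeasure P := by
    rw [hP, walkLaw_eq_trajMeasure]; infer_instance
  have h1 : ∫⁻ ω, (H.unmetBefore U (N + 1)).indicator (fun ω => F (ω (N + 1)).arc) ω ∂P =
      ∫⁻ ω, (H.unmetBefore U (N + 1)).indicator
        (fun ω => ∫⁻ y, F y.arc ∂(H.stepPMF hout (ω N)).toMeasure) ω ∂P := by
    calc _ = ∫⁻ ω, G (Preorder.frestrictLe N ω, ω (N + 1)) ∂P := by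
          refine lintegral_congr fun ω => ?_
          by_cases h : ω ∈ H.unmetBefore U (N + 1)
          · simp [G, h, (hSmem ω).2 h]
          · simp [G, h, (hSmem ω).not.2 h]
      _ = ∫⁻ p, G p ∂(P.map fun x => (Preorder.frestrictLe N x, x (N + 1))) := by
          rw [lintegral_map hG (by fun_prop)]
      _ = ∫⁻ x, ∫⁻ y, G (x, y) ∂(H.stepKernel hout N x) ∂(P.map (Preorder.frestrictLe N)) := by
          rw [← key, Measure.lintegral_compProd hG]
      _ = ∫⁻ ω, ∫⁻ y, G (Preorder.frestrictLe N ω, y)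
            ∂(H.stepKernel hout N (Preorder.frestrictLe N ω)) ∂P := by
          rw [lintegral_map hG.lintegral_kernel_prod_right' (by fun_prop)]
      _ = _ := by
          refine lintegral_congr fun ω => ?_
          have h2 : H.stepKernel hout N (Preorder.frestrictLe N ω) =
            (H.stepPMF hout (ω N)).toMeasure := rfl
          rw [h2]
          by_cases h : ω ∈ H.unmetBefore U (N + 1)
          · simp [G, h, (hSmem ω).2 h]
          · simp [G, h, (hSmem ω).not.2 h]
  rw [h1, ← lintegral_add_right _ (measurable_one.indicator (H.measurableSet_unmetBefore U _))]
  refine lintegral_mono fun ω => ?_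
  by_cases h : ω ∈ H.unmetBefore U (N + 1)
  · have h' : ω ∈ H.unmetBefore U N := fun i hi => h i (by omega)
    simpa [h, h'] using hF (ω N) (h N (by omega))
  · simp [h]

/-- A Lyapunov bound: if `F` decreases by at least one in mean at every step made on an arc that
does not meet `U`, then it bounds the radio hitting time to `U`. -/
theorem radioHittingTime_le_lintegral (U : Set V) (F : E → ℝ≥0∞)
    (hF : ∀ x : WalkState V E, ¬ H.Meets x.arc U →
      ∫⁻ y, F y.arc ∂(H.stepPMF hout x).toMeasure + 1 ≤ F x.arc) (v : V) (c : ℝ≥0∞)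
    (hc : ∀ e, F e ≤ c) :
    H.radioHittingTime hout v U ≤ c := by
  have : IsProbabilityMeasure (H.walkLaw hout v) := by
    rw [walkLaw_eq_trajMeasure]; infer_instance
  -- Telescoped drift: expected time already spent plus expected potential still available never
  -- exceeds `c`.
  have hsum : ∀ N, ∑ t ∈ Finset.range N,
      ∫⁻ ω, (H.unmetBefore U (t + 1)).indicator 1 ω ∂H.walkLaw hout v +
      ∫⁻ ω, (H.unmetBefore U N).indicator (fun ω => F (ω N).arc) ω ∂H.walkLaw hout v ≤ c := by
    intro N
    induction N with
    | zero =>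
      calc _ ≤ ∫⁻ _, c ∂H.walkLaw hout v := by
            simp only [Finset.range_zero, Finset.sum_empty, zero_add]
            exact lintegral_mono fun ω => Set.indicator_apply_le' (fun _ => hc _) fun _ => zero_le
        _ = c := by simp
    | succ N ih =>
      refine le_trans ?_ ih
      rw [Finset.sum_range_succ, add_assoc]
      gcongr
      rw [add_comm]
      exact H.lintegral_unmetBefore_succ_le hout U F hF v N
  calc H.radioHittingTime hout v U
      ≤ ∫⁻ ω, ∑' t, (H.unmetBefore U (t + 1)).indicator 1 ω ∂H.walkLaw hout v :=
        lintegral_mono fun ω => H.radioTime_le_tsum U ω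
    _ = ∑' t, ∫⁻ ω, (H.unmetBefore U (t + 1)).indicator 1 ω ∂H.walkLaw hout v :=
        lintegral_tsum fun t =>
          (measurable_one.indicator (H.measurableSet_unmetBefore U _)).aemeasurable
    _ ≤ c := by
        rw [ENNReal.tsum_eq_iSup_nat]
        exact iSup_le fun N => le_self_add.trans (hsum N)

end DirHypergraph

/-! ### Symmetries and moments of the `L₁` ball in `ℤ²`. -/

noncomputable section

/-- The nonzero points of `ℤ²` of `L₁`-norm at most `k`. -/
def puncturedDiamond (k : ℕ) : Finset (ℤ × ℤ) :=
  (Finset.Icc (-(k : ℤ)) k ×ˢ Finset.Icc (-(k : ℤ)) k).filter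
    fun z => z ≠ 0 ∧ z.1.natAbs + z.2.natAbs ≤ k

theorem mem_puncturedDiamond {k : ℕ} {z : ℤ × ℤ} :
    z ∈ puncturedDiamond k ↔ z ≠ 0 ∧ z.1.natAbs + z.2.natAbs ≤ k := by
  simp only [puncturedDiamond, Finset.mem_filter, Finset.mem_product, Finset.mem_Icc]
  refine ⟨fun h => h.2, fun h => ⟨?_, h⟩⟩
  omega

theorem sum_puncturedDiamond_rotate {M : Type*} [AddCommMonoid M] (k : ℕ) (f : ℤ × ℤ → M) :
    ∑ z ∈ puncturedDiamond k, f (-z.2, z.1) = ∑ z ∈ puncturedDiamond k, f z := by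
  refine Finset.sum_nbij' (fun z => (-z.2, z.1)) (fun z => (z.2, -z.1)) ?_ ?_ ?_ ?_ ?_ <;>
    simp [mem_puncturedDiamond, Prod.ext_iff] <;> omega

theorem sum_puncturedDiamond_neg_fst {M : Type*} [AddCommMonoid M] (k : ℕ) (f : ℤ × ℤ → M) :
    ∑ z ∈ puncturedDiamond k, f (-z.1, z.2) = ∑ z ∈ puncturedDiamond k, f z := by
  refine Finset.sum_nbij' (fun z => (-z.1, z.2)) (fun z => (-z.1, z.2)) ?_ ?_ ?_ ?_ ?_ <;>
    simp [mem_puncturedDiamond, Prod.ext_iff]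

theorem sum_puncturedDiamond_swap {M : Type*} [AddCommMonoid M] (k : ℕ) (f : ℤ × ℤ → M) :
    ∑ z ∈ puncturedDiamond k, f (z.2, z.1) = ∑ z ∈ puncturedDiamond k, f z := by
  refine Finset.sum_nbij' (fun z => (z.2, z.1)) (fun z => (z.2, z.1)) ?_ ?_ ?_ ?_ ?_ <;>
    simp [mem_puncturedDiamond, Prod.ext_iff] <;> omega

theorem card_puncturedDiamond_sphere {k j : ℕ} (hj : 1 ≤ j) (hjk : j ≤ k) :
    ((puncturedDiamond k).filter fun z => z.1.natAbs + z.2.natAbs = j).card = 4 * j := by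
  -- The sphere is cut into four half-open sides of `j` points each, so every corner is counted
  -- once.
  let g : ℕ × ℕ → ℤ × ℤ := fun p =>
    if p.1 = 0 then ((j : ℤ) - p.2, (p.2 : ℤ)) else if p.1 = 1 then (-(p.2 : ℤ), (j : ℤ) - p.2)
    else if p.1 = 2 then ((p.2 : ℤ) - j, -(p.2 : ℤ)) else ((p.2 : ℤ), (p.2 : ℤ) - j)
  have : ((puncturedDiamond k).filter fun z => z.1.natAbs + z.2.natAbs = j) =
      (Finset.range 4 ×ˢ Finset.range j).image g := by
    ext ⟨a, b⟩
    simp only [Finset.mem_filter, mem_puncturedDiamond, Finset.mem_image, Finset.mem_product,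
      Finset.mem_range, Prod.exists, ne_eq, Prod.ext_iff, Prod.fst_zero, Prod.snd_zero]
    constructor
    · rintro ⟨_, h⟩
      by_cases h0 : 0 < a ∧ 0 ≤ b
      · exact ⟨0, b.toNat, by omega, by simp [g]; omega⟩
      by_cases h1 : a ≤ 0 ∧ 0 < b
      · exact ⟨1, (-a).toNat, by omega, by simp [g]; omega⟩
      by_cases h2 : a < 0 ∧ b ≤ 0
      · exact ⟨2, (-b).toNat, by omega, by simp [g]; omega⟩
      · exact ⟨3, a.toNat, by omega, by simp [g]; omega⟩
    · rintro ⟨i, m, ⟨hi, hm⟩, h1, h2⟩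
      interval_cases i <;> simp [g] at h1 h2 <;> omega
  rw [this, Finset.card_image_of_injOn, Finset.card_product, Finset.card_range, Finset.card_range]
  rintro ⟨i, m⟩ hi ⟨i', m'⟩ hi' h
  simp only [Finset.coe_product, Finset.coe_range, Set.mem_prod, Set.mem_Iio] at hi hi'
  obtain ⟨hi, hm⟩ := hi
  obtain ⟨hi', hm'⟩ := hi'
  interval_cases i <;> interval_cases i' <;> simp [g] at h ⊢ <;> omega

/-- Sums of radial functions over the punctured diamond. -/
theorem sum_puncturedDiamond_radial (k : ℕ) (φ : ℕ → ℝ) :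
    ∑ z ∈ puncturedDiamond k, φ (z.1.natAbs + z.2.natAbs) =
      ∑ j ∈ Finset.range k, 4 * ((j : ℝ) + 1) * φ (j + 1) := by
  rw [← Finset.sum_fiberwise_of_maps_to (s := puncturedDiamond k) (t := Finset.Icc 1 k)
    (g := fun z => z.1.natAbs + z.2.natAbs)]
  · have h := Finset.sum_Ico_add' (fun j : ℕ => 4 * (j : ℝ) * φ j) 0 k 1
    simp only [Nat.cast_add, Nat.cast_one, zero_add] at h
    rw [Finset.range_eq_Ico, h]
    refine Finset.sum_congr (by ext; simp) fun j hj => ?_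
    have hj' := Finset.mem_Icc.1 hj
    rw [Finset.sum_congr rfl (g := fun _ => φ j), Finset.sum_const,
      card_puncturedDiamond_sphere hj'.1 (by omega)]
    · simp
    · intro z hz
      rw [(Finset.mem_filter.1 hz).2]
  · intro z hz
    have := mem_puncturedDiamond.1 hz
    simp only [ne_eq, Prod.ext_iff, Prod.fst_zero, Prod.snd_zero] at this
    simp only [Finset.mem_Icc]
    omega

theorem card_puncturedDiamond (k : ℕ) : (puncturedDiamond k).card = 2 * k * (k + 1) := by
  have h := sum_puncturedDiamond_radial k fun _ => 1
  have h2 : ∀ k : ℕ, ∑ j ∈ Finset.range k, 4 * ((j : ℝ) + 1) * 1 = 2 * (k : ℝ) * (k + 1) := by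
    intro k
    induction k with
    | zero => simp
    | succ k ih => rw [Finset.sum_range_succ, ih]; push_cast; ring
  rw [h2, Finset.sum_const, nsmul_eq_mul, mul_one] at h
  exact_mod_cast h

theorem sum_puncturedDiamond_norm (k : ℕ) :
    ∑ z ∈ puncturedDiamond k, (|(z.1 : ℝ)| + |(z.2 : ℝ)|) =
      2 * k * (k + 1) * ((2 * k + 1) / 3) := by
  have h := sum_puncturedDiamond_radial k fun j => j
  have h2 : ∀ k : ℕ, ∑ j ∈ Finset.range k, 4 * ((j : ℝ) + 1) * ((j + 1 : ℕ) : ℝ) =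
      2 * k * (k + 1) * ((2 * k + 1) / 3) := by
    intro k
    induction k with
    | zero => simp
    | succ k ih => rw [Finset.sum_range_succ, ih]; push_cast; ring
  rw [← h2, ← h]
  simp [Nat.cast_natAbs]

theorem sum_puncturedDiamond_norm_sq (k : ℕ) :
    ∑ z ∈ puncturedDiamond k, (|(z.1 : ℝ)| + |(z.2 : ℝ)|) ^ 2 =
      2 * (k : ℝ) * (k + 1) * (k * (k + 1) / 2) := by
  have h := sum_puncturedDiamond_radial k fun j => (j : ℝ) ^ 2
  have h2 : ∀ k : ℕ, ∑ j ∈ Finset.range k, 4 * ((j : ℝ) + 1) * ((j + 1 : ℕ) : ℝ) ^ 2 =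
      2 * (k : ℝ) * (k + 1) * (k * (k + 1) / 2) := by
    intro k
    induction k with
    | zero => simp
    | succ k ih => rw [Finset.sum_range_succ, ih]; push_cast; ring
  rw [← h2, ← h]
  simp [Nat.cast_natAbs]

theorem four_mul_sum_puncturedDiamond (k : ℕ) (f : ℤ × ℤ → ℝ) :
    4 * ∑ z ∈ puncturedDiamond k, f z =
      ∑ z ∈ puncturedDiamond k,
        (f (z.1, z.2) + f (-z.2, z.1) + f (-z.1, -z.2) + f (z.2, -z.1)) := by
  have h1 := sum_puncturedDiamond_rotate k f
  have h2 := sum_puncturedDiamond_rotate k fun z => f (-z.2, z.1)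
  have h3 := sum_puncturedDiamond_rotate k fun z => f (-z.1, -z.2)
  simp only [neg_neg] at h2 h3
  simp only [Finset.sum_add_distrib, Prod.mk.eta]
  linarith

theorem four_mul_sum_puncturedDiamond_reflect (k : ℕ) (f : ℤ × ℤ → ℝ) :
    4 * ∑ z ∈ puncturedDiamond k, f z =
      ∑ z ∈ puncturedDiamond k,
        (f (z.1, z.2) + f (-z.1, z.2) + f (z.1, -z.2) + f (-z.1, -z.2)) := by
  have h1 := sum_puncturedDiamond_neg_fst k f
  have h2 := sum_puncturedDiamond_rotate k fun z => f (-z.2, z.1)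
  have h3 := sum_puncturedDiamond_rotate k f
  have h4 := sum_puncturedDiamond_neg_fst k fun z => f (-z.1, -z.2)
  simp only [neg_neg] at h2 h4
  simp only [Finset.sum_add_distrib, Prod.mk.eta]
  linarith

/-! ### The smoothed logarithm averaged over rotated steps. -/

theorem rotation_factors_pos {β : ℝ} (hβ : 0 < β) (p q a b : ℝ) :
    0 < (p + a) ^ 2 + (q + b) ^ 2 + β := by positivity

/-- The product over the four rotations of a step is controlled by the arithmetic-geometric mean
inequality. -/
theorem prod_rotations_le (β p q a b : ℝ) :
    ((p + a) ^ 2 + (q + b) ^ 2 + β) * ((p + -b) ^ 2 + (q + a) ^ 2 + β) *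
      (((p + -a) ^ 2 + (q + -b) ^ 2 + β) * ((p + b) ^ 2 + (q + -a) ^ 2 + β)) ≤
    ((p ^ 2 + q ^ 2 + β) ^ 2 + ((a ^ 2 + b ^ 2) ^ 2 + 2 * β * (a ^ 2 + b ^ 2))) ^ 2 := by
  have h : ((p ^ 2 + q ^ 2 + β) ^ 2 + ((a ^ 2 + b ^ 2) ^ 2 + 2 * β * (a ^ 2 + b ^ 2))) ^ 2 -
      ((p + a) ^ 2 + (q + b) ^ 2 + β) * ((p + -b) ^ 2 + (q + a) ^ 2 + β) *
      (((p + -a) ^ 2 + (q + -b) ^ 2 + β) * ((p + b) ^ 2 + (q + -a) ^ 2 + β)) =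
      (2 * (p * a + q * b) ^ 2 - 2 * (q * a - p * b) ^ 2) ^ 2 := by ring
  nlinarith [sq_nonneg (2 * (p * a + q * b) ^ 2 - 2 * (q * a - p * b) ^ 2)]

theorem sum_log_rotations_le {β : ℝ} (hβ : 0 < β) (p q a b : ℝ) :
    Real.log ((p + a) ^ 2 + (q + b) ^ 2 + β) + Real.log ((p + -b) ^ 2 + (q + a) ^ 2 + β) +
      Real.log ((p + -a) ^ 2 + (q + -b) ^ 2 + β) + Real.log ((p + b) ^ 2 + (q + -a) ^ 2 + β) ≤
    4 * Real.log (p ^ 2 + q ^ 2 + β) +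
      2 * (((a ^ 2 + b ^ 2) ^ 2 + 2 * β * (a ^ 2 + b ^ 2)) / (p ^ 2 + q ^ 2 + β) ^ 2) := by
  have h1 := rotation_factors_pos hβ p q a b
  have h2 := rotation_factors_pos hβ p q (-b) a
  have h3 := rotation_factors_pos hβ p q (-a) (-b)
  have h4 := rotation_factors_pos hβ p q b (-a)
  have hR : 0 < p ^ 2 + q ^ 2 + β := by positivity
  have hprod := prod_rotations_le β p q a b
  set R := p ^ 2 + q ^ 2 + β
  set e := (a ^ 2 + b ^ 2) ^ 2 + 2 * β * (a ^ 2 + b ^ 2)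
  have he : 0 ≤ e := by positivity
  have hM : R ^ 2 + e = R ^ 2 * (1 + e / R ^ 2) := by field_simp
  have hlog : Real.log (1 + e / R ^ 2) ≤ e / R ^ 2 := by
    have := Real.log_le_sub_one_of_pos (show 0 < 1 + e / R ^ 2 by positivity)
    linarith
  have hle := Real.log_le_log (by positivity) hprod
  rw [Real.log_mul (by positivity) (by positivity), Real.log_mul h1.ne' h2.ne',
    Real.log_mul h3.ne' h4.ne', Real.log_pow, hM, Real.log_mul (by positivity) (by positivity),
    Real.log_pow] at hle
  push_cast at hle
  linarith

theorem four_div_add_le {X Y : ℝ} (hX : 0 < X) (hY : 0 < Y) : 4 / (X + Y) ≤ 1 / X + 1 / Y := by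
  rw [div_add_div _ _ hX.ne' hY.ne', div_le_div_iff₀ (by positivity) (by positivity)]
  nlinarith [sq_nonneg (X - Y)]

/-- Opposite steps pair up: the two denominators have sum `2(R + ζ)`, where `R = p² + q² + β` and `ζ
= a² + b²`. Convexity of the reciprocal then combines the two pairs, whose denominator products have
an explicit sum. -/
theorem le_sum_inv_rotations {β : ℝ} (hβ : 0 < β) (p q a b : ℝ) :
    4 * ((p ^ 2 + q ^ 2 + β + (a ^ 2 + b ^ 2)) /
      ((p ^ 2 + q ^ 2 + β) ^ 2 + ((a ^ 2 + b ^ 2) ^ 2 + 2 * β * (a ^ 2 + b ^ 2)))) ≤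
    1 / ((p + a) ^ 2 + (q + b) ^ 2 + β) + 1 / ((p + -b) ^ 2 + (q + a) ^ 2 + β) +
      1 / ((p + -a) ^ 2 + (q + -b) ^ 2 + β) + 1 / ((p + b) ^ 2 + (q + -a) ^ 2 + β) := by
  have h1 := rotation_factors_pos hβ p q a b
  have h2 := rotation_factors_pos hβ p q (-b) a
  have h3 := rotation_factors_pos hβ p q (-a) (-b)
  have h4 := rotation_factors_pos hβ p q b (-a)
  have hX := mul_pos h1 h3
  have hY := mul_pos h2 h4
  have h := four_div_add_le hX hY
  have h13 : 1 / ((p + a) ^ 2 + (q + b) ^ 2 + β) + 1 / ((p + -a) ^ 2 + (q + -b) ^ 2 + β) =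
      2 * (p ^ 2 + q ^ 2 + β + (a ^ 2 + b ^ 2)) *
        (1 / (((p + a) ^ 2 + (q + b) ^ 2 + β) * ((p + -a) ^ 2 + (q + -b) ^ 2 + β))) := by
    field_simp
    ring
  have h24 : 1 / ((p + -b) ^ 2 + (q + a) ^ 2 + β) + 1 / ((p + b) ^ 2 + (q + -a) ^ 2 + β) =
      2 * (p ^ 2 + q ^ 2 + β + (a ^ 2 + b ^ 2)) *
        (1 / (((p + -b) ^ 2 + (q + a) ^ 2 + β) * ((p + b) ^ 2 + (q + -a) ^ 2 + β))) := by
    field_simp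
    ring
  have hS : 0 ≤ 2 * (p ^ 2 + q ^ 2 + β + (a ^ 2 + b ^ 2)) := by positivity
  have hXY : ((p + a) ^ 2 + (q + b) ^ 2 + β) * ((p + -a) ^ 2 + (q + -b) ^ 2 + β) +
      ((p + -b) ^ 2 + (q + a) ^ 2 + β) * ((p + b) ^ 2 + (q + -a) ^ 2 + β) =
      2 * ((p ^ 2 + q ^ 2 + β) ^ 2 + ((a ^ 2 + b ^ 2) ^ 2 + 2 * β * (a ^ 2 + b ^ 2))) := by ring
  have hM : 0 < (p ^ 2 + q ^ 2 + β) ^ 2 + ((a ^ 2 + b ^ 2) ^ 2 + 2 * β * (a ^ 2 + b ^ 2)) := by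
    positivity
  rw [hXY] at h
  calc _ = 2 * (p ^ 2 + q ^ 2 + β + (a ^ 2 + b ^ 2)) * (4 / (2 * ((p ^ 2 + q ^ 2 + β) ^ 2 +
        ((a ^ 2 + b ^ 2) ^ 2 + 2 * β * (a ^ 2 + b ^ 2))))) := by field_simp
    _ ≤ _ := mul_le_mul_of_nonneg_left h hS
    _ = _ := by rw [mul_add, ← h13, ← h24]; ring

/-- A smoothed logarithm of the squared distance, nearly superharmonic at scale `κ`. -/
def smoothLog (κ y : ℝ) : ℝ := Real.log (y + κ) - 4 * κ * (1 / (y + κ))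

/-- For `R ≥ 6κ` the denominator is at most `13/12 · R²` and `R - ζ - 2κ ≥ R/2`. The gain is thus at
least `48/13 · κζ/(2R²)`, while the loss is at most `3κζ/(2R²)`. -/
theorem correction_dominates {κ R ζ : ℝ} (hκ : 0 < κ) (hζ : 0 ≤ ζ) (hζκ : ζ ≤ κ)
    (hR : 6 * κ ≤ R) :
    (ζ ^ 2 + 2 * κ * ζ) / (2 * R ^ 2) ≤
      4 * κ * ((R + ζ) / (R ^ 2 + (ζ ^ 2 + 2 * κ * ζ)) - 1 / R) := by
  have hR0 : 0 < R := by linarith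
  have hM : 0 < R ^ 2 + (ζ ^ 2 + 2 * κ * ζ) := by positivity
  have hMR : R ^ 2 + (ζ ^ 2 + 2 * κ * ζ) ≤ 13 / 12 * R ^ 2 := by nlinarith
  have e1 : (R + ζ) / (R ^ 2 + (ζ ^ 2 + 2 * κ * ζ)) - 1 / R =
      ζ * (R - ζ - 2 * κ) / (R * (R ^ 2 + (ζ ^ 2 + 2 * κ * ζ))) := by
    field_simp
    ring
  have e2 : ζ * (R / 2) / (R * (13 / 12 * R ^ 2)) ≤
      ζ * (R - ζ - 2 * κ) / (R * (R ^ 2 + (ζ ^ 2 + 2 * κ * ζ))) := by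
    apply div_le_div₀
    · exact mul_nonneg hζ (by linarith)
    · exact mul_le_mul_of_nonneg_left (by linarith) hζ
    · positivity
    · exact mul_le_mul_of_nonneg_left hMR hR0.le
  rw [e1]
  refine le_trans ?_ (mul_le_mul_of_nonneg_left e2 (by positivity))
  have e3 : 4 * κ * (ζ * (R / 2) / (R * (13 / 12 * R ^ 2))) = (48 / 13 * (κ * ζ)) / (2 * R ^ 2) := by
    field_simp
    ring
  rw [e3]
  gcongr
  nlinarith [mul_nonneg hκ.le hζ]

theorem sum_smoothLog_rotations_le {κ : ℝ} (hκ : 0 < κ) (p q a b : ℝ) (hab : a ^ 2 + b ^ 2 ≤ κ) :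
    smoothLog κ ((p + a) ^ 2 + (q + b) ^ 2) + smoothLog κ ((p + -b) ^ 2 + (q + a) ^ 2) +
      smoothLog κ ((p + -a) ^ 2 + (q + -b) ^ 2) + smoothLog κ ((p + b) ^ 2 + (q + -a) ^ 2) ≤
    4 * smoothLog κ (p ^ 2 + q ^ 2) + if p ^ 2 + q ^ 2 < 5 * κ then 22 else 0 := by
  have hlog := sum_log_rotations_le hκ p q a b
  have hζ : 0 ≤ a ^ 2 + b ^ 2 := by positivity
  have hρ : 0 ≤ p ^ 2 + q ^ 2 := by positivity
  have hR : 0 < p ^ 2 + q ^ 2 + κ := by positivity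
  unfold smoothLog
  split_ifs with h
  -- Close to the target, `22 = 2·3 + 4·4`: the logarithmic error plus the correction at the centre,
  -- discarding the four favourable terms at the neighbours.
  · have i1 : ((a ^ 2 + b ^ 2) ^ 2 + 2 * κ * (a ^ 2 + b ^ 2)) / (p ^ 2 + q ^ 2 + κ) ^ 2 ≤ 3 := by
      rw [div_le_iff₀ (by positivity)]
      nlinarith
    have i2 : κ * (1 / (p ^ 2 + q ^ 2 + κ)) ≤ 1 := by
      rw [mul_one_div, div_le_one hR]
      linarith
    have g1 := mul_pos hκ (one_div_pos.2 (rotation_factors_pos hκ p q a b))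
    have g2 := mul_pos hκ (one_div_pos.2 (rotation_factors_pos hκ p q (-b) a))
    have g3 := mul_pos hκ (one_div_pos.2 (rotation_factors_pos hκ p q (-a) (-b)))
    have g4 := mul_pos hκ (one_div_pos.2 (rotation_factors_pos hκ p q b (-a)))
    linarith
  · have hinv := mul_le_mul_of_nonneg_left (le_sum_inv_rotations hκ p q a b)
      (show 0 ≤ 4 * κ by positivity)
    have hc := correction_dominates (R := p ^ 2 + q ^ 2 + κ) hκ hζ hab (by linarith)
    have e : ((a ^ 2 + b ^ 2) ^ 2 + 2 * κ * (a ^ 2 + b ^ 2)) / (2 * (p ^ 2 + q ^ 2 + κ) ^ 2) =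
      ((a ^ 2 + b ^ 2) ^ 2 + 2 * κ * (a ^ 2 + b ^ 2)) / (p ^ 2 + q ^ 2 + κ) ^ 2 / 2 := by
      field_simp
    rw [e] at hc
    linarith

theorem sq_add_sq_le_of_mem_puncturedDiamond {k : ℕ} {z : ℤ × ℤ} (hz : z ∈ puncturedDiamond k) :
    (z.1 : ℝ) ^ 2 + (z.2 : ℝ) ^ 2 ≤ (k : ℝ) ^ 2 := by
  have h : |(z.1 : ℝ)| + |(z.2 : ℝ)| ≤ k := by
    have := (mem_puncturedDiamond.1 hz).2
    rw [← Int.cast_abs, ← Int.cast_abs, Int.abs_eq_natAbs, Int.abs_eq_natAbs]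
    exact_mod_cast this
  rw [← sq_abs (z.1 : ℝ), ← sq_abs (z.2 : ℝ)]
  nlinarith [abs_nonneg (z.1 : ℝ), abs_nonneg (z.2 : ℝ)]

theorem sum_smoothLog_le {k : ℕ} (hk : 1 ≤ k) (p q : ℝ) :
    ∑ z ∈ puncturedDiamond k, smoothLog ((k : ℝ) ^ 2) ((p + z.1) ^ 2 + (q + z.2) ^ 2) ≤
      2 * k * (k + 1) * (smoothLog ((k : ℝ) ^ 2) (p ^ 2 + q ^ 2) +
        if p ^ 2 + q ^ 2 < 5 * (k : ℝ) ^ 2 then 6 else 0) := by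
  have hκ : (0 : ℝ) < (k : ℝ) ^ 2 := by positivity
  have h := four_mul_sum_puncturedDiamond k
    fun z => smoothLog ((k : ℝ) ^ 2) ((p + z.1) ^ 2 + (q + z.2) ^ 2)
  have h2 := Finset.sum_le_sum fun z (hz : z ∈ puncturedDiamond k) =>
    sum_smoothLog_rotations_le hκ p q z.1 z.2 (sq_add_sq_le_of_mem_puncturedDiamond hz)
  simp only [Int.cast_neg] at h
  rw [← h, Finset.sum_const, card_puncturedDiamond, nsmul_eq_mul] at h2
  push_cast at h2
  have hd : (0 : ℝ) ≤ 2 * k * (k + 1) := by positivity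
  split_ifs at h2 ⊢ <;> linarith

/-! ### Drift of the quadratic and Gaussian terms. -/

theorem sum_sq_add_sq_ge (k : ℕ) (p q : ℝ) :
    2 * k * (k + 1) * (p ^ 2 + q ^ 2 + k * (k + 1) / 4) ≤
      ∑ z ∈ puncturedDiamond k, ((p + z.1) ^ 2 + (q + z.2) ^ 2) := by
  have h := four_mul_sum_puncturedDiamond k fun z => ((p + z.1) ^ 2 + (q + z.2) ^ 2)
  have h2 : ∀ z ∈ puncturedDiamond k,
      4 * (p ^ 2 + q ^ 2) + 2 * (|(z.1 : ℝ)| + |(z.2 : ℝ)|) ^ 2 ≤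
      (p + (z.1 : ℝ)) ^ 2 + (q + (z.2 : ℝ)) ^ 2 + ((p + -z.2) ^ 2 + (q + z.1) ^ 2) +
        ((p + -z.1) ^ 2 + (q + -z.2) ^ 2) + ((p + z.2) ^ 2 + (q + -z.1) ^ 2) := by
    intro z _
    nlinarith [sq_abs (z.1 : ℝ), sq_abs (z.2 : ℝ), sq_nonneg (|(z.1 : ℝ)| - |(z.2 : ℝ)|)]
  have h3 := Finset.sum_le_sum h2
  simp only [Int.cast_neg] at h
  rw [← h, Finset.sum_add_distrib, ← Finset.mul_sum, ← Finset.mul_sum,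
    sum_puncturedDiamond_norm_sq,
    Finset.sum_const, card_puncturedDiamond, nsmul_eq_mul] at h3
  push_cast at h3
  linarith

/-- One of the four sign choices points the step towards the origin in both coordinates; its term
alone suffices. -/
theorem exp_neg_sub_abs_le_sum_reflect (μ p q a b : ℝ) :
    Real.exp (-(μ * ((|p| - |a|) ^ 2 + (|q| - |b|) ^ 2))) ≤
      Real.exp (-(μ * ((p + a) ^ 2 + (q + b) ^ 2))) +
      Real.exp (-(μ * ((p + -a) ^ 2 + (q + b) ^ 2))) +
      Real.exp (-(μ * ((p + a) ^ 2 + (q + -b) ^ 2))) +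
      Real.exp (-(μ * ((p + -a) ^ 2 + (q + -b) ^ 2))) := by
  have h1 : (|p| - |a|) ^ 2 = (p + a) ^ 2 ∨ (|p| - |a|) ^ 2 = (p + -a) ^ 2 := by
    rcases abs_cases p with ⟨h, _⟩ | ⟨h, _⟩ <;> rcases abs_cases a with ⟨h', _⟩ | ⟨h', _⟩ <;>
      rw [h, h'] <;> first | (left; ring1) | (right; ring1)
  have h2 : (|q| - |b|) ^ 2 = (q + b) ^ 2 ∨ (|q| - |b|) ^ 2 = (q + -b) ^ 2 := by
    rcases abs_cases q with ⟨h, _⟩ | ⟨h, _⟩ <;> rcases abs_cases b with ⟨h', _⟩ | ⟨h', _⟩ <;>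
      rw [h, h'] <;> first | (left; ring1) | (right; ring1)
  have e1 := Real.exp_pos (-(μ * ((p + a) ^ 2 + (q + b) ^ 2)))
  have e2 := Real.exp_pos (-(μ * ((p + -a) ^ 2 + (q + b) ^ 2)))
  have e3 := Real.exp_pos (-(μ * ((p + a) ^ 2 + (q + -b) ^ 2)))
  have e4 := Real.exp_pos (-(μ * ((p + -a) ^ 2 + (q + -b) ^ 2)))
  rcases h1 with h1 | h1 <;> rcases h2 with h2 | h2 <;> rw [h1, h2] <;> linarith

/-- Outside the diamond, the Gaussian at scale `k` at least doubles in mean in one step. -/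
theorem sum_exp_ge {k : ℕ} (hk : 1 ≤ k) (p q : ℝ) (hpq : (k : ℝ) + 1 ≤ |p| + |q|) :
    2 * k * (k + 1) * (2 * Real.exp (-(42 / (k : ℝ) ^ 2 * (p ^ 2 + q ^ 2)))) ≤
      ∑ z ∈ puncturedDiamond k, Real.exp (-(42 / (k : ℝ) ^ 2 * ((p + z.1) ^ 2 + (q + z.2) ^ 2))) := by
  have hk0 : (0 : ℝ) < k := by exact_mod_cast hk
  set μ : ℝ := 42 / (k : ℝ) ^ 2 with hμ
  have hμ0 : 0 < μ := by positivity
  have h := four_mul_sum_puncturedDiamond_reflect k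
    fun z => Real.exp (-(μ * ((p + z.1) ^ 2 + (q + z.2) ^ 2)))
  simp only [Int.cast_neg] at h
  have hterm : ∀ z ∈ puncturedDiamond k,
      Real.exp (-(μ * (p ^ 2 + q ^ 2))) * (1 + μ * (2 * (|p| * |(z.1 : ℝ)|) +
        2 * (|q| * |(z.2 : ℝ)|) - (|(z.1 : ℝ)| + |(z.2 : ℝ)|) ^ 2)) ≤
      Real.exp (-(μ * ((p + z.1) ^ 2 + (q + z.2) ^ 2))) +
      Real.exp (-(μ * ((p + -z.1) ^ 2 + (q + z.2) ^ 2))) +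
      Real.exp (-(μ * ((p + z.1) ^ 2 + (q + -z.2) ^ 2))) +
      Real.exp (-(μ * ((p + -z.1) ^ 2 + (q + -z.2) ^ 2))) := by
    intro z _
    refine le_trans ?_ (exp_neg_sub_abs_le_sum_reflect μ p q z.1 z.2)
    have e : -(μ * ((|p| - |(z.1 : ℝ)|) ^ 2 + (|q| - |(z.2 : ℝ)|) ^ 2)) =
        -(μ * (p ^ 2 + q ^ 2)) + μ * (2 * (|p| * |(z.1 : ℝ)|) + 2 * (|q| * |(z.2 : ℝ)|) -
          (|(z.1 : ℝ)| ^ 2 + |(z.2 : ℝ)| ^ 2)) := by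
      rw [← sq_abs p, ← sq_abs q]; ring
    rw [e, Real.exp_add]
    refine mul_le_mul_of_nonneg_left ?_ (Real.exp_pos _).le
    refine le_trans ?_ (Real.add_one_le_exp _)
    rw [add_comm]
    gcongr
    nlinarith [mul_nonneg (abs_nonneg (z.1 : ℝ)) (abs_nonneg (z.2 : ℝ))]
  have hsum := Finset.sum_le_sum hterm
  rw [← h, ← Finset.mul_sum, Finset.sum_add_distrib, ← Finset.mul_sum, Finset.sum_sub_distrib,
    Finset.sum_add_distrib, ← Finset.mul_sum, ← Finset.mul_sum, ← Finset.mul_sum, ← Finset.mul_sum,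
    sum_puncturedDiamond_norm_sq, Finset.sum_const, card_puncturedDiamond, nsmul_eq_mul] at hsum
  have hswap := sum_puncturedDiamond_swap k fun z => |(z.1 : ℝ)|
  have hnorm := sum_puncturedDiamond_norm k
  rw [Finset.sum_add_distrib] at hnorm
  simp only at hswap
  set T := ∑ z ∈ puncturedDiamond k, |(z.1 : ℝ)|
  rw [hswap] at hsum hnorm
  push_cast at hsum
  have hT : 2 * T = 2 * k * (k + 1) * ((2 * k + 1) / 3) := by linarith
  have hd : (0 : ℝ) < 2 * k * (k + 1) := by positivity
  have hT0 : 0 ≤ 2 * T := by rw [hT]; positivity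
  have hin : 2 * (k : ℝ) * (k + 1) * 8 ≤ 2 * k * (k + 1) * 1 + μ * (2 * (|p| * T) + 2 * (|q| * T) -
      2 * k * (k + 1) * (k * (k + 1) / 2)) := by
    -- Using `k + 1` rather than `k` matters: with `k` the final margin would be `k(k-1)/6`, which
    -- vanishes at `k = 1`. The rate `42 = 6·7` turns the margin `k²/6` into 7, so the four
    -- reflections give `1 + 7 = 8`, twice the original value on average.
    have h1 : (k + 1) * (2 * T) ≤ 2 * (|p| * T) + 2 * (|q| * T) := by nlinarith
    have h2 : 2 * (k : ℝ) * (k + 1) * (k ^ 2 / 6) ≤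
        2 * (|p| * T) + 2 * (|q| * T) - 2 * k * (k + 1) * (k * (k + 1) / 2) := by
      refine le_trans ?_ (sub_le_sub_right h1 _)
      rw [hT, show ((k : ℝ) + 1) * (2 * k * (k + 1) * ((2 * k + 1) / 3)) -
        2 * k * (k + 1) * (k * (k + 1) / 2) = 2 * k * (k + 1) * ((k + 1) * (k + 2) / 6) by ring]
      refine mul_le_mul_of_nonneg_left ?_ hd.le
      nlinarith
    have h3 := mul_le_mul_of_nonneg_left h2 hμ0.le
    have h4 : μ * (2 * (k : ℝ) * (k + 1) * (k ^ 2 / 6)) = 2 * k * (k + 1) * 7 := by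
      rw [hμ]; field_simp; norm_num
    linarith
  have := mul_le_mul_of_nonneg_left hin (Real.exp_pos (-(μ * (p ^ 2 + q ^ 2)))).le
  linarith

/-! ### The combined potential in the plane. -/

/-- A Lyapunov function of the squared distance to the target. -/
def torusPotential (s k : ℕ) (y : ℝ) : ℝ :=
  3 * (4 / ((k : ℝ) * (k + 1))) * (s : ℝ) ^ 2 *
    (smoothLog ((k : ℝ) ^ 2) y - 6 * Real.exp 210 * Real.exp (-(42 / (k : ℝ) ^ 2 * y))) -
    4 / ((k : ℝ) * (k + 1)) * y

theorem sum_torusPotential_add_le (s : ℕ) {k : ℕ} (hk : 1 ≤ k) (p q : ℝ)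
    (hpq : (k : ℝ) + 1 ≤ |p| + |q|) :
    ∑ z ∈ puncturedDiamond k, torusPotential s k ((p + z.1) ^ 2 + (q + z.2) ^ 2) +
      2 * k * (k + 1) ≤ 2 * k * (k + 1) * torusPotential s k (p ^ 2 + q ^ 2) := by
  have hk0 : (0 : ℝ) < k := by exact_mod_cast hk
  have h1 := sum_smoothLog_le hk p q
  have h2 := sum_sq_add_sq_ge k p q
  have h3 := sum_exp_ge hk p q hpq
  have hd : (0 : ℝ) < 2 * k * (k + 1) := by positivity
  -- On `y < 5k²` the Gaussian is at least `exp(-42·5)`, so the factor `exp 210` makes its gain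
  -- cover the excess 6.
  have hK : (if p ^ 2 + q ^ 2 < 5 * (k : ℝ) ^ 2 then (6 : ℝ) else 0) ≤
      6 * Real.exp 210 * Real.exp (-(42 / (k : ℝ) ^ 2 * (p ^ 2 + q ^ 2))) := by
    split_ifs with h
    · rw [mul_assoc, ← Real.exp_add]
      have : 42 / (k : ℝ) ^ 2 * (p ^ 2 + q ^ 2) ≤ 210 := by
        rw [div_mul_eq_mul_div, div_le_iff₀ (by positivity)]
        linarith
      have := Real.one_le_exp
        (show 0 ≤ 210 + -(42 / (k : ℝ) ^ 2 * (p ^ 2 + q ^ 2)) by linarith)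
      linarith
    · positivity
  unfold torusPotential
  rw [Finset.sum_sub_distrib, ← Finset.mul_sum, ← Finset.mul_sum, Finset.sum_sub_distrib,
    ← Finset.mul_sum]
  have hA : 0 ≤ 3 * (4 / ((k : ℝ) * (k + 1))) * (s : ℝ) ^ 2 := by positivity
  have hB : 0 < 4 / ((k : ℝ) * (k + 1)) := by positivity
  have hBk : 4 / ((k : ℝ) * (k + 1)) * (k * (k + 1) / 4) = 1 := by field_simp
  have h2' := mul_le_mul_of_nonneg_left h2 hB.le
  have h4 : ∑ z ∈ puncturedDiamond k, smoothLog ((k : ℝ) ^ 2) ((p + z.1) ^ 2 + (q + z.2) ^ 2) -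
      6 * Real.exp 210 * ∑ z ∈ puncturedDiamond k,
        Real.exp (-(42 / (k : ℝ) ^ 2 * ((p + z.1) ^ 2 + (q + z.2) ^ 2))) ≤
      2 * k * (k + 1) * (smoothLog ((k : ℝ) ^ 2) (p ^ 2 + q ^ 2) -
        6 * Real.exp 210 * Real.exp (-(42 / (k : ℝ) ^ 2 * (p ^ 2 + q ^ 2)))) := by
    have h3' := mul_le_mul_of_nonneg_left h3 (show 0 ≤ 6 * Real.exp 210 by positivity)
    have hK' := mul_le_mul_of_nonneg_left hK hd.le
    linarith
  have h4' := mul_le_mul_of_nonneg_left h4 hA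
  have h5 : 4 / ((k : ℝ) * (k + 1)) * (2 * k * (k + 1) * (p ^ 2 + q ^ 2 + k * (k + 1) / 4)) =
      2 * k * (k + 1) * (4 / ((k : ℝ) * (k + 1)) * (p ^ 2 + q ^ 2)) + 2 * k * (k + 1) := by
    linear_combination (2 * (k : ℝ) * (k + 1)) * hBk
  linarith

/-- In this range `y + k² ≤ 3s²`, so the logarithm has slope at least `1/(3s²)`. Its coefficient
`3s²·4/(k(k+1))` therefore offsets the linear term, and the other two terms are increasing. -/
theorem torusPotential_mono {s k : ℕ} (hk : 1 ≤ k) (hks : k ≤ s) {x y : ℝ} (hx : 0 ≤ x)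
    (hxy : x ≤ y) (hy : y ≤ 2 * (s : ℝ) ^ 2) : torusPotential s k x ≤ torusPotential s k y := by
  have hk0 : (0 : ℝ) < k := by exact_mod_cast hk
  have hks' : (k : ℝ) ≤ s := by exact_mod_cast hks
  have hs0 : (0 : ℝ) < s := hk0.trans_le hks'
  have hκ : (k : ℝ) ^ 2 ≤ (s : ℝ) ^ 2 := by gcongr
  have hxk : 0 < x + (k : ℝ) ^ 2 := by positivity
  have hyk : 0 < y + (k : ℝ) ^ 2 := by linarith
  have hlog : (y - x) / (3 * (s : ℝ) ^ 2) ≤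
      Real.log (y + (k : ℝ) ^ 2) - Real.log (x + (k : ℝ) ^ 2) := by
    have h := Real.log_le_sub_one_of_pos (div_pos hxk hyk)
    rw [Real.log_div hxk.ne' hyk.ne'] at h
    have e : (x + (k : ℝ) ^ 2) / (y + (k : ℝ) ^ 2) - 1 = -((y - x) / (y + (k : ℝ) ^ 2)) := by
      field_simp
      ring
    have : (y - x) / (3 * (s : ℝ) ^ 2) ≤ (y - x) / (y + (k : ℝ) ^ 2) :=
      div_le_div_of_nonneg_left (by linarith) hyk (by linarith)
    linarith
  have hinv : 4 * (k : ℝ) ^ 2 * (1 / (y + (k : ℝ) ^ 2)) ≤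
      4 * (k : ℝ) ^ 2 * (1 / (x + (k : ℝ) ^ 2)) := by gcongr
  have hexp : 6 * Real.exp 210 * Real.exp (-(42 / (k : ℝ) ^ 2 * y)) ≤
      6 * Real.exp 210 * Real.exp (-(42 / (k : ℝ) ^ 2 * x)) := by gcongr
  unfold torusPotential smoothLog
  have hB : 0 < 4 / ((k : ℝ) * (k + 1)) := by positivity
  set B := 4 / ((k : ℝ) * (k + 1))
  have h := mul_le_mul_of_nonneg_left hlog (show 0 ≤ 3 * B * (s : ℝ) ^ 2 by positivity)
  have e : 3 * B * (s : ℝ) ^ 2 * ((y - x) / (3 * (s : ℝ) ^ 2)) = B * (y - x) := by field_simp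
  have h' := mul_le_mul_of_nonneg_left (add_le_add hinv hexp)
    (show 0 ≤ 3 * B * (s : ℝ) ^ 2 by positivity)
  linarith

theorem torusPotential_sub_le {s k : ℕ} (hk : 1 ≤ k) (hs : 2 * k + 1 ≤ s) {y : ℝ} (hy0 : 0 ≤ y)
    (hy : y ≤ (s : ℝ) ^ 2 / 2) :
    torusPotential s k y - torusPotential s k 0 ≤
      24 * (11 + 12 * Real.exp 210) * ((s : ℝ) ^ 2 / (2 * k * (k + 1)) *
        Real.log ((s : ℝ) ^ 2 / (2 * k * (k + 1)))) := by
  have hk0 : (1 : ℝ) ≤ k := by exact_mod_cast hk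
  have hs' : 2 * (k : ℝ) + 1 ≤ s := by exact_mod_cast hs
  have hr : 3 * (4 / ((k : ℝ) * (k + 1))) * (s : ℝ) ^ 2 =
      24 * ((s : ℝ) ^ 2 / (2 * k * (k + 1))) := by field_simp; ring
  have hr2 : 2 ≤ (s : ℝ) ^ 2 / (2 * k * (k + 1)) := by
    rw [le_div_iff₀ (by positivity)]
    nlinarith
  have hrk : (s : ℝ) ^ 2 / (2 * k ^ 2) ≤ 2 * ((s : ℝ) ^ 2 / (2 * k * (k + 1))) := by
    rw [← mul_div_assoc, div_le_div_iff₀ (by positivity) (by positivity)]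
    nlinarith [mul_nonneg (sq_nonneg (s : ℝ)) (show 0 ≤ (k : ℝ) * (k - 1) by nlinarith)]
  unfold torusPotential smoothLog
  rw [hr]
  set r := (s : ℝ) ^ 2 / (2 * k * (k + 1))
  -- Since `r ≥ 2`, `log r` is bounded below and absorbs the additive constant `4 + 6·exp 210` at
  -- the cost of a factor 2.
  have hlog2 : 1 / 2 ≤ Real.log r := by
    have := Real.log_le_log (by norm_num) hr2
    linarith [Real.log_two_gt_d9]
  have hlog : Real.log (y + (k : ℝ) ^ 2) - Real.log (0 + (k : ℝ) ^ 2) ≤ 3 * Real.log r := by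
    rw [zero_add, ← Real.log_div (by positivity) (by positivity)]
    have e : (3 : ℝ) * Real.log r = Real.log (r ^ 3) := by rw [Real.log_pow]; norm_num
    rw [e]
    apply Real.log_le_log (by positivity)
    have e2 : (y + (k : ℝ) ^ 2) / (k : ℝ) ^ 2 ≤ 1 + (s : ℝ) ^ 2 / (2 * k ^ 2) := by
      rw [div_le_iff₀ (by positivity)]
      have : (1 + (s : ℝ) ^ 2 / (2 * k ^ 2)) * k ^ 2 = k ^ 2 + s ^ 2 / 2 := by field_simp
      linarith
    -- The ratio is at most `1 + 2r`, and `1 + 2r ≤ 4r ≤ r³` for `r ≥ 2`.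
    nlinarith [mul_nonneg (show 0 ≤ r by linarith) (show 0 ≤ r ^ 2 - 4 by nlinarith)]
  have hinv : 0 ≤ 4 * (k : ℝ) ^ 2 * (1 / (y + (k : ℝ) ^ 2)) := by positivity
  have hinv0 : 4 * (k : ℝ) ^ 2 * (1 / (0 + (k : ℝ) ^ 2)) = 4 := by
    rw [zero_add]; field_simp
  have hexp : 0 ≤ 6 * Real.exp 210 * Real.exp (-(42 / (k : ℝ) ^ 2 * y)) := by positivity
  have hexp0 : 6 * Real.exp 210 * Real.exp (-(42 / (k : ℝ) ^ 2 * 0)) = 6 * Real.exp 210 := by simp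
  have hB : 0 ≤ 4 / ((k : ℝ) * (k + 1)) * y := by positivity
  rw [hinv0, hexp0]
  have hmain : Real.log (y + (k : ℝ) ^ 2) - 4 * (k : ℝ) ^ 2 * (1 / (y + (k : ℝ) ^ 2)) -
      6 * Real.exp 210 * Real.exp (-(42 / (k : ℝ) ^ 2 * y)) -
      (Real.log (0 + (k : ℝ) ^ 2) - 4 - 6 * Real.exp 210) ≤
      (11 + 12 * Real.exp 210) * Real.log r := by
    have := mul_le_mul_of_nonneg_left hlog2 (show 0 ≤ 8 + 12 * Real.exp 210 by positivity)
    linarith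
  have := mul_le_mul_of_nonneg_left hmain (show 0 ≤ 24 * r by linarith)
  linarith

/-! ### From the plane to the torus. -/

section Torus

variable {s k : ℕ}

theorem valMinAbs_intCast_of_natAbs_le [NeZero s] (hs : 2 * k + 1 ≤ s) {a : ℤ} (ha : a.natAbs ≤ k) :
    (a : ZMod s).valMinAbs = a := by
  rw [ZMod.valMinAbs_spec]
  refine ⟨rfl, ?_, ?_⟩ <;> omega

/-- The translate of a vertex of the torus by an integer vector. -/
def torusShift (s : ℕ) (e : ZMod s × ZMod s) (z : ℤ × ℤ) : ZMod s × ZMod s :=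
  (e.1 + (z.1 : ZMod s), e.2 + (z.2 : ZMod s))

theorem torusShift_injOn [NeZero s] (hs : 2 * k + 1 ≤ s) (e : ZMod s × ZMod s) :
    Set.InjOn (torusShift s e) (puncturedDiamond k : Set (ℤ × ℤ)) := by
  intro z hz z' hz' h
  have hz := (mem_puncturedDiamond.1 hz).2
  have hz' := (mem_puncturedDiamond.1 hz').2
  simp only [torusShift, Prod.mk.injEq, add_right_inj] at h
  ext
  · rw [← valMinAbs_intCast_of_natAbs_le hs (a := z.1) (by omega), h.1,
      valMinAbs_intCast_of_natAbs_le hs (by omega)]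
  · rw [← valMinAbs_intCast_of_natAbs_le hs (a := z.2) (by omega), h.2,
      valMinAbs_intCast_of_natAbs_le hs (by omega)]

theorem torusRadio_dst_eq [NeZero s] (hk : 1 ≤ k) (hs : 2 * k + 1 ≤ s) (hs2 : 2 ≤ s)
    (e : ZMod s × ZMod s) :
    (torusRadio s k hs2 hk).dst e = (puncturedDiamond k).image (torusShift s e) := by
  ext w
  simp only [torusRadio, Finset.mem_filter, Finset.mem_univ, true_and, Finset.mem_image]
  constructor
  · rintro ⟨hne, hw⟩
    refine ⟨((w.1 - e.1).valMinAbs, (w.2 - e.2).valMinAbs), ?_, ?_⟩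
    · refine mem_puncturedDiamond.2 ⟨fun h => hne ?_, hw⟩
      simp only [Prod.ext_iff, Prod.fst_zero, Prod.snd_zero, ZMod.valMinAbs_eq_zero,
        sub_eq_zero] at h
      exact Prod.ext h.1 h.2
    · simp [torusShift, ZMod.coe_valMinAbs]
  · rintro ⟨z, hz, rfl⟩
    obtain ⟨hz0, hzk⟩ := mem_puncturedDiamond.1 hz
    have h1 := valMinAbs_intCast_of_natAbs_le hs (a := z.1) (by omega)
    have h2 := valMinAbs_intCast_of_natAbs_le hs (a := z.2) (by omega)
    refine ⟨fun h => hz0 ?_, ?_⟩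
    · simp only [torusShift, Prod.ext_iff, add_eq_left] at h
      rw [← ZMod.valMinAbs_eq_zero, ← ZMod.valMinAbs_eq_zero, h1, h2] at h
      exact Prod.ext h.1 h.2
    · simpa [torusDist, torusShift, h1, h2] using hzk

theorem torusRadio_card_dst [NeZero s] (hk : 1 ≤ k) (hs : 2 * k + 1 ≤ s) (hs2 : 2 ≤ s)
    (e : ZMod s × ZMod s) : ((torusRadio s k hs2 hk).dst e).card = 2 * k * (k + 1) := by
  rw [torusRadio_dst_eq hk hs, Finset.card_image_of_injOn (torusShift_injOn hs e),
    card_puncturedDiamond]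

/-- The squared Euclidean distance between two vertices of the torus. -/
def torusSqDist (v w : ZMod s × ZMod s) : ℝ :=
  ((w.1 - v.1).valMinAbs : ℝ) ^ 2 + ((w.2 - v.2).valMinAbs : ℝ) ^ 2

theorem valMinAbs_sq_le [NeZero s] (a : ZMod s) : (a.valMinAbs : ℝ) ^ 2 ≤ ((s : ℝ) / 2) ^ 2 := by
  have h := a.natAbs_valMinAbs_le
  have h' : (2 * a.valMinAbs.natAbs : ℝ) ≤ s := by exact_mod_cast (by omega)
  rw [Nat.cast_natAbs, Int.cast_abs] at h'
  exact sq_le_sq' (by linarith [neg_abs_le (a.valMinAbs : ℝ)])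
    (by linarith [le_abs_self (a.valMinAbs : ℝ)])

/-- The minimal representative of a sum is no larger than the sum of the representatives; this is
where wrapping around helps. -/
theorem valMinAbs_add_intCast_sq_le [NeZero s] (hs : 2 * k + 1 ≤ s) (a : ZMod s) {z : ℤ}
    (hz : z.natAbs ≤ k) :
    ((a + (z : ZMod s)).valMinAbs : ℝ) ^ 2 ≤ ((a.valMinAbs : ℝ) + z) ^ 2 := by
  have h := ZMod.natAbs_valMinAbs_add_le a (z : ZMod s)
  rw [valMinAbs_intCast_of_natAbs_le hs hz] at h
  exact_mod_cast Int.natAbs_le_iff_sq_le.1 h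

theorem valMinAbs_add_sq_le [NeZero s] (hs : 2 * k + 1 ≤ s) (a : ZMod s) {z : ℤ}
    (hz : z.natAbs ≤ k) : ((a.valMinAbs : ℝ) + z) ^ 2 ≤ (s : ℝ) ^ 2 := by
  have h := a.natAbs_valMinAbs_le
  have h1 : (a.valMinAbs + z).natAbs ≤ ((s : ℕ) : ℤ).natAbs := by omega
  exact_mod_cast Int.natAbs_le_iff_sq_le.1 h1

/-- The torus potential centred at `v`, normalised to vanish at `v`. -/
def torusLyapunov (k : ℕ) (v w : ZMod s × ZMod s) : ℝ :=
  torusPotential s k (torusSqDist v w) - torusPotential s k 0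

theorem torusSqDist_nonneg (v w : ZMod s × ZMod s) : 0 ≤ torusSqDist v w := by
  unfold torusSqDist; positivity

theorem torusSqDist_le [NeZero s] (v w : ZMod s × ZMod s) :
    torusSqDist v w ≤ (s : ℝ) ^ 2 / 2 := by
  have h1 := valMinAbs_sq_le (w.1 - v.1)
  have h2 := valMinAbs_sq_le (w.2 - v.2)
  unfold torusSqDist
  linarith

theorem torusLyapunov_nonneg [NeZero s] (hk : 1 ≤ k) (hs : 2 * k + 1 ≤ s)
    (v w : ZMod s × ZMod s) : 0 ≤ torusLyapunov k v w :=
  sub_nonneg.2 <| torusPotential_mono hk (by omega) le_rfl (torusSqDist_nonneg v w)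
    ((torusSqDist_le v w).trans (by nlinarith [sq_nonneg (s : ℝ)]))

/-- Steps are lifted to `ℤ²` from the minimal representative of `e - v`. Monotonicity bounds the
torus potential by the planar one, whose argument stays at most `2s²` even for unwrapped points. -/
theorem sum_torusLyapunov_dst_add_le [NeZero s] (hk : 1 ≤ k) (hs : 2 * k + 1 ≤ s) (hs2 : 2 ≤ s)
    (v e : ZMod s × ZMod s) (hve : k < torusDist e v) :
    ∑ w ∈ (torusRadio s k hs2 hk).dst e, torusLyapunov k v w + 2 * k * (k + 1) ≤
      2 * k * (k + 1) * torusLyapunov k v e := by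
  rw [torusRadio_dst_eq hk hs, Finset.sum_image (torusShift_injOn hs e)]
  have hpq : (k : ℝ) + 1 ≤ |((e.1 - v.1).valMinAbs : ℝ)| + |((e.2 - v.2).valMinAbs : ℝ)| := by
    rw [torusDist, ← neg_sub e.1, ← neg_sub e.2, ZMod.natAbs_valMinAbs_neg,
      ZMod.natAbs_valMinAbs_neg] at hve
    rw [← Int.cast_abs, ← Int.cast_abs, ← Nat.cast_natAbs, ← Nat.cast_natAbs]
    exact_mod_cast hve
  have h := sum_torusPotential_add_le s hk _ _ hpq
  have hle : ∀ z ∈ puncturedDiamond k, torusLyapunov k v (torusShift s e z) ≤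
      torusPotential s k ((((e.1 - v.1).valMinAbs : ℝ) + z.1) ^ 2 +
        (((e.2 - v.2).valMinAbs : ℝ) + z.2) ^ 2) - torusPotential s k 0 := by
    intro z hz
    have hz := (mem_puncturedDiamond.1 hz).2
    refine sub_le_sub_right (torusPotential_mono hk (by omega) (torusSqDist_nonneg _ _) ?_ ?_) _
    · refine add_le_add ?_ ?_
      · rw [torusShift, add_sub_right_comm]
        exact valMinAbs_add_intCast_sq_le hs _ (by omega)
      · rw [torusShift, add_sub_right_comm]
        exact valMinAbs_add_intCast_sq_le hs _ (by omega)
    · rw [two_mul]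
      exact add_le_add (valMinAbs_add_sq_le hs _ (by omega)) (valMinAbs_add_sq_le hs _ (by omega))
  have h2 := Finset.sum_le_sum hle
  rw [Finset.sum_sub_distrib, Finset.sum_const, card_puncturedDiamond, nsmul_eq_mul] at h2
  push_cast at h2
  unfold torusLyapunov at h2 ⊢
  unfold torusSqDist at h2 ⊢
  linarith

/-! ### The walk on the torus radio hyper-graph. -/

theorem torusRadio_chooseArc [NeZero s] (hk : 1 ≤ k) (hs2 : 2 ≤ s) (v : ZMod s × ZMod s) :
    (torusRadio s k hs2 hk).chooseArc (torusRadio_out s k hs2 hk) v = PMF.pure ⟨v, v⟩ := by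
  have h : (torusRadio s k hs2 hk).outArcs v = {v} := by
    ext e
    simp [DirHypergraph.outArcs, torusRadio, eq_comm]
  have h2 : PMF.uniformOfFinset ((torusRadio s k hs2 hk).outArcs v)
      (DirHypergraph.outArcs_nonempty _ (torusRadio_out s k hs2 hk v)) = PMF.pure v := by
    ext e
    rw [PMF.uniformOfFinset_apply, h, PMF.pure_apply]
    simp
  rw [DirHypergraph.chooseArc, h2, PMF.pure_map]

theorem lintegral_uniformOfFinset {α : Type*} [Fintype α] [MeasurableSpace α]
    [MeasurableSingletonClass α] (S : Finset α) (hS : S.Nonempty) (f : α → ℝ≥0∞) :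
    ∫⁻ x, f x ∂(PMF.uniformOfFinset S hS).toMeasure = (∑ x ∈ S, f x) / S.card := by
  classical
  rw [lintegral_fintype]
  simp_rw [PMF.toMeasure_apply_singleton _ _ (measurableSet_singleton _),
    PMF.uniformOfFinset_apply, mul_ite, mul_zero]
  rw [Finset.sum_ite_mem, Finset.univ_inter, ← Finset.sum_mul, div_eq_mul_inv]

theorem lintegral_torusRadio_stepPMF [NeZero s] (hk : 1 ≤ k) (hs2 : 2 ≤ s)
    (x : WalkState (ZMod s × ZMod s) (ZMod s × ZMod s)) (F : ZMod s × ZMod s → ℝ≥0∞) :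
    ∫⁻ y, F y.arc ∂((torusRadio s k hs2 hk).stepPMF (torusRadio_out s k hs2 hk) x).toMeasure =
      (∑ w ∈ (torusRadio s k hs2 hk).dst x.arc, F w) / ((torusRadio s k hs2 hk).dst x.arc).card := by
  let : MeasurableSpace (ZMod s × ZMod s) := ⊤
  have h : (torusRadio s k hs2 hk).chooseArc (torusRadio_out s k hs2 hk) =
      PMF.pure ∘ fun v => ⟨v, v⟩ := funext (torusRadio_chooseArc hk hs2)
  rw [DirHypergraph.stepPMF, h, PMF.bind_pure_comp, ← PMF.toMeasure_map _ _ measurable_from_top,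
    lintegral_map measurable_from_top measurable_from_top, lintegral_uniformOfFinset]

theorem torusRadio_radioHittingTime_le [NeZero s] (hk : 1 ≤ k) (hs : 2 * k + 1 ≤ s) (hs2 : 2 ≤ s)
    (u v : ZMod s × ZMod s) :
    (torusRadio s k hs2 hk).radioHittingTime (torusRadio_out s k hs2 hk) u {v} ≤
      ENNReal.ofReal (24 * (11 + 12 * Real.exp 210) * ((s : ℝ) ^ 2 / (2 * k * (k + 1)) *
        Real.log ((s : ℝ) ^ 2 / (2 * k * (k + 1))))) := by
  refine DirHypergraph.radioHittingTime_le_lintegral _ _ _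
    (fun w => ENNReal.ofReal (torusLyapunov k v w)) (fun x hx => ?_) u _ fun w =>
      ENNReal.ofReal_le_ofReal
        (torusPotential_sub_le hk hs (torusSqDist_nonneg v w) (torusSqDist_le v w))
  -- An arc misses `v` exactly when `v` lies outside the ball, the region where the Gaussian
  -- estimate is available.
  have hdist : k < torusDist x.arc v := by
    by_contra hle
    refine hx ⟨v, rfl, ?_⟩
    by_cases hv : v = x.arc
    · left; simp [torusRadio, hv]
    · right; simp [torusRadio, hv, not_lt.1 hle]
  have h := sum_torusLyapunov_dst_add_le hk hs hs2 v x.arc hdist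
  have hd : (0 : ℝ) < 2 * k * (k + 1) := by
    have : (0 : ℝ) < k := by exact_mod_cast hk
    positivity
  rw [lintegral_torusRadio_stepPMF hk hs2 x fun w => ENNReal.ofReal (torusLyapunov k v w),
    torusRadio_card_dst hk hs, ← ENNReal.ofReal_sum_of_nonneg
      fun w _ => torusLyapunov_nonneg hk hs v w]
  have hcast : ((2 * k * (k + 1) : ℕ) : ℝ≥0∞) = ENNReal.ofReal (2 * k * (k + 1)) := by
    rw [← ENNReal.ofReal_natCast]; push_cast; rfl
  rw [hcast, ← ENNReal.ofReal_div_of_pos hd, ← ENNReal.ofReal_one,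
    ← ENNReal.ofReal_add (div_nonneg (Finset.sum_nonneg fun w _ =>
      torusLyapunov_nonneg hk hs v w) hd.le) zero_le_one]
  apply ENNReal.ofReal_le_ofReal
  rw [div_add_one hd.ne', div_le_iff₀ hd]
  linarith

end Torus

end

theorem mainTheorem8 :
    ∃ C : ℝ, 0 < C ∧ ∀ (s k : ℕ) [NeZero s] (hk : 1 ≤ k) (hs : 2 * k + 1 ≤ s),
      (torusRadio s k (by omega) hk).IsUniformOfDegree (2 * k * (k + 1)) ∧
      ∀ n d : ℕ, n = s ^ 2 → d = 2 * k * (k + 1) →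
        (torusRadio s k (by omega) hk).maxRadioHittingTime (torusRadio_out s k (by omega) hk) ≤
          ENNReal.ofReal (C * ((n : ℝ) / d * Real.log ((n : ℝ) / d))) := by
  refine ⟨24 * (11 + 12 * Real.exp 210), by positivity, fun s k _ hk hs =>
    ⟨torusRadio_card_dst hk hs (by omega), ?_⟩⟩
  rintro n d rfl rfl
  refine iSup₂_le fun u v => ?_
  have h := torusRadio_radioHittingTime_le hk hs (by omega) u v
  push_cast
  exact h
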